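/- All graphs are finite, simple and undirected. A set $C$ of vertices of a graph $G$ is monophonically convex if every induced path of $G$ joining two vertices of $C$ is contained in $C$. The hull $\langle S\rangle$ of $S\subseteq V(G)$ is the smallest monophonically convex set containing $S$. The set $S$ is monophonically convexly independent if $u\notin\langle S\setminus\{u\}\rangle$ for every $u\in S$. A connected graph is prime if it has no clique separator, that is, no clique whose removal disconnects it (the graph with no vertices is not counted as connected). An mp-subgraph of a graph $G'$ is a maximal prime induced subgraph of $G'$. For an mp-subgraph $M$ of $G'$, let $\partial M$ be the set of vertices of $M$ that belong to other mp-subgraphs of $G'$, and let $M^\circ=V(M)\setminus\partial M$. We call $M$ a petal (or leaf) of $G'$ if $M^\circ\neq\varnothing$ and $\partial M$ is a clique (possibly empty). The flower subgraphs of $G$ are $G$ itself and every graph $G'-M^\circ$ where $G'$ is a flower subgraph of $G$ and $M$ is a petal of $G'$. For a petal $M$ of $G'$, a set $X\subseteq M^\circ$ is a stamen set of $M$ in $G'$ if one of the following holds: - (Type 1) $|X|=1$; - (Type 2) $X=\{u_1,u_2\}$ with $u_1\ne u_2$, and $\partial M\subseteq N(u_1)$ and $\partial M\subseteq N(u_2)$;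 - (Type 3) $|X|\ge 2$ and $X\cup\partial M$ is a clique. **Theorem.** Let $G$ be a connected graph and let $S\subseteq V(G)$. There is a flower subgraph of $G$ that is minimal under inclusion among the flower subgraphs containing $\langle S\rangle$. For every such minimal flower subgraph $H$, the set $S$ is monophonically convexly independent if and only if every mp-subgraph $M$ of $H$ satisfies the following: if $M$ is a petal of $H$, then $S\cap V(M)$ is contained in a stamen set of $M$ in $H$; otherwise $S\cap V(M)=\varnothing$. -/

import Mathlib

namespace Monophonic

variable {V : Type*}

/-- An induced path: a path without chords. -/
def IsInducedPath (G : SimpleGraph V) {u v : V} (p : G.Walk u v) : Prop :=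
  p.IsPath ∧ p.IsChordless

/-- `C` is monophonically convex: every induced path joining two vertices of `C` lies in `C`. -/
def IsConvex (G : SimpleGraph V) (C : Set V) : Prop :=
  ∀ u ∈ C, ∀ v ∈ C, ∀ p : G.Walk u v, IsInducedPath G p → ∀ x ∈ p.support, x ∈ C

/-- The monophonic convex hull `⟨S⟩`, the intersection of all convex sets that contain `S`. -/
def hull (G : SimpleGraph V) (S : Set V) : Set V :=
  ⋂₀ {C | IsConvex G C ∧ S ⊆ C}

/-- The hull is the smallest convex set that contains `S`. -/
theorem hull_isLeast (G : SimpleGraph V) (S : Set V) :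
    IsLeast {C | IsConvex G C ∧ S ⊆ C} (hull G S) :=
  ⟨⟨fun u hu v hv p hp x hx C hC => hC.1 u (hu C hC) v (hv C hC) p hp x hx,
    fun _ hx _ hC => hC.2 hx⟩, fun _ hC => Set.sInter_subset_of_mem hC⟩

/-- `S` is monophonically convexly independent. -/
def IsConvexlyIndependent (G : SimpleGraph V) (S : Set V) : Prop :=
  ∀ u ∈ S, u ∉ hull G (S \ {u})

/-! Induced subgraphs of `G` are represented by their vertex sets: below, `U` stands for the
induced subgraph `G[U]`, and `M` for the induced subgraph `G[M]`. -/

/-- `C` is a clique separator of the connected graph `G[U]`: it is a clique of `G[U]` and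
`G[U] - C` is disconnected, i.e. two of its vertices are not joined by a path. -/
def IsCliqueSeparator (G : SimpleGraph V) (U C : Set V) : Prop :=
  C ⊆ U ∧ G.IsClique C ∧ ¬ (G.induce (U \ C)).Preconnected

/-- `G[M]` is a prime graph: it is connected and has no clique separator. -/
def IsPrimeOn (G : SimpleGraph V) (M : Set V) : Prop :=
  (G.induce M).Connected ∧ ∀ C, ¬ IsCliqueSeparator G M C

/-- `G[M]` is an mp-subgraph of `G[U]`: a maximal prime induced subgraph of `G[U]`. -/
def IsMPSubgraph (G : SimpleGraph V) (U M : Set V) : Prop :=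
  Maximal (fun M => M ⊆ U ∧ IsPrimeOn G M) M

/-- The vertices of `M` that belong to other mp-subgraphs of `G[U]`. -/
def border (G : SimpleGraph V) (U M : Set V) : Set V :=
  {v | v ∈ M ∧ ∃ M', IsMPSubgraph G U M' ∧ M' ≠ M ∧ v ∈ M'}

/-- The vertices of `M` that belong to no other mp-subgraph of `G[U]`. -/
def inner (G : SimpleGraph V) (U M : Set V) : Set V :=
  M \ border G U M

/-- `G[M]` is a petal (a leaf) of `G[U]`: an mp-subgraph with non-empty inner part whose border
is a clique. -/
def IsPetal (G : SimpleGraph V) (U M : Set V) : Prop :=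
  IsMPSubgraph G U M ∧ (inner G U M).Nonempty ∧ G.IsClique (border G U M)

/-- The flower subgraphs of `G`: `G` itself, and all graphs obtained from a flower subgraph by
deleting the inner part of one of its petals. -/
inductive IsFlower (G : SimpleGraph V) : Set V → Prop
  | whole : IsFlower G Set.univ
  | deletePetal (U M : Set V) :
      IsFlower G U → IsPetal G U M → IsFlower G (U \ inner G U M)

/-- `G[H]` is a minimal flower subgraph of `G` containing `⟨S⟩`. -/
def IsMinFlowerContainingHull (G : SimpleGraph V) (S H : Set V) : Prop :=
  Minimal (fun U => IsFlower G U ∧ hull G S ⊆ U) H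

/-- `X` is a stamen set for the petal `M` of `G[U]`; the three cases are Types 1, 2 and 3. -/
def IsStamenSet (G : SimpleGraph V) (U M X : Set V) : Prop :=
  X ⊆ inner G U M ∧
    ((∃ u, X = {u}) ∨
     (∃ u₁ u₂, u₁ ≠ u₂ ∧ X = {u₁, u₂} ∧
        border G U M ⊆ G.neighborSet u₁ ∧ border G U M ⊆ G.neighborSet u₂) ∨
     (G.IsClique (X ∪ border G U M) ∧ 2 ≤ X.ncard))

end Monophonic

/-!
A vertex set `U` is handled through boundaries: the boundary of `D` in `G[U]` is the set of vertices
of `G[U] - D` with a neighbour in `D`. Two facts link boundaries to convexity. Deleting a set with a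
clique boundary from a convex set leaves a convex set (`IsConvex.diff`), and conversely the
components of the complement of a convex set have clique boundaries
(`IsConvex.exists_component`), because two nonadjacent boundary vertices would be joined by an
induced path outside the convex set. It follows that flower subgraphs are convex
(`IsFlower.isConvex`), and that a convex set containing two nonadjacent vertices of a prime graph
contains the whole prime graph (`IsPrimeOn.subset_of_isConvex`).

The combinatorial core is `exists_isPetal_inner_subset`: if `D` has a clique boundary and some
vertex of `D` is in the inner part of no petal, then `D` contains the whole inner part of a petal.
Hence a convex set that meets the inner part of every petal of `H` contains all vertices outside
these inner parts (`IsConvex.mem_of_forall_inter_inner`).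

Let `H` be a minimal flower subgraph containing `⟨S⟩`. By minimality `S` meets the inner part of
every petal of `H`. If `S` is independent and `u ∈ S`, then `u` is in the inner part `M°` of a
petal `M`; otherwise `S \ {u}` meets all inner parts and its hull contains `u`. Moreover
`(S ∩ M) \ {u}` and `∂M` together form a clique; otherwise the hull of `S \ {u}` contains two
nonadjacent vertices of the prime graph `M`, hence `M`. This clique condition for all `u ∈ S ∩ M` is
equivalent to `S ∩ M` extending to a stamen set (`exists_isStamenSet_iff`). Conversely, the clique
condition makes `H \ (M° \ S) \ {u}` a convex set that contains `S \ {u}` but not `u`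
(`not_mem_hull_diff_singleton`).
-/

namespace Monophonic

variable {V : Type*} {G : SimpleGraph V}

/-! ### Induced paths and convex sets -/

/-- The set of vertices of `G[U] - D` that have a neighbour in `D`. -/
def boundary (G : SimpleGraph V) (U D : Set V) : Set V :=
  {w | w ∈ U ∧ w ∉ D ∧ ∃ d ∈ D, G.Adj d w}

/-- A walk of minimal length among those inside `T` is an induced path. -/
theorem exists_inducedPath_of_walk {T : Set V} {a b : V} (p : G.Walk a b)
    (hp : ∀ x ∈ p.support, x ∈ T) :
    ∃ q : G.Walk a b, IsInducedPath G q ∧ ∀ x ∈ q.support, x ∈ T := by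
  classical
  have hex : ∃ n, ∃ q : G.Walk a b, q.length = n ∧ ∀ x ∈ q.support, x ∈ T := ⟨_, p, rfl, hp⟩
  obtain ⟨r, hrl, hrT⟩ := Nat.find_spec hex
  have hmin : ∀ q : G.Walk a b, (∀ x ∈ q.support, x ∈ T) → r.length ≤ q.length := fun q hq =>
    hrl ▸ Nat.find_min' hex ⟨q, rfl, hq⟩
  have hqT : ∀ x ∈ r.bypass.support, x ∈ T := fun x hx => hrT x (r.support_bypass_subset_support hx)
  have hle : r.bypass.length ≤ r.length := r.length_bypass_le_length
  refine ⟨r.bypass, ⟨r.bypass_isPath, ?_⟩, hqT⟩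
  generalize r.bypass = q at hqT hle
  have key : ∀ i j, i < j → j ≤ q.length → G.Adj (q.getVert i) (q.getVert j) →
      s(q.getVert i, q.getVert j) ∈ q.edges := by
    intro i j hij hj hadj
    obtain rfl | hlt : j = i + 1 ∨ i + 1 < j := by omega
    · rw [← SimpleGraph.Walk.adj_toSubgraph_iff_mem_edges, SimpleGraph.Walk.toSubgraph_adj_iff]
      exact ⟨i, rfl, by omega⟩
    · exfalso
      have := hmin ((q.take i).append (.cons hadj (q.drop j))) (by
        intro x hx
        rw [SimpleGraph.Walk.mem_support_append_iff, SimpleGraph.Walk.support_cons,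
          List.mem_cons] at hx
        rcases hx with hx | rfl | hx
        · exact hqT x ((q.isSubwalk_take i).support_subset hx)
        · exact hqT _ (q.getVert_mem_support i)
        · exact hqT x ((q.isSubwalk_drop j).support_subset hx))
      simp only [SimpleGraph.Walk.length_append, SimpleGraph.Walk.length_cons,
        SimpleGraph.Walk.take_length, SimpleGraph.Walk.drop_length] at this
      omega
  rw [SimpleGraph.Walk.isChordless_iff_forall_mem_edges]
  intro u v hu hv huv
  obtain ⟨i, rfl, hi⟩ := SimpleGraph.Walk.mem_support_iff_exists_getVert.1 hu
  obtain ⟨j, rfl, hj⟩ := SimpleGraph.Walk.mem_support_iff_exists_getVert.1 hv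
  rcases lt_trichotomy i j with h | rfl | h
  · exact key i j h hj huv
  · exact (G.irrefl huv).elim
  · rw [Sym2.eq_swap]
    exact key j i h hi huv.symm

/-- Two vertices of a convex set that can be joined through the complement are adjacent: a shortest
connection of that kind would otherwise leave the convex set. -/
theorem IsConvex.adj_of_walk {C : Set V} (hC : IsConvex G C) {a b c d : V} (ha : a ∈ C) (hb : b ∈ C)
    (hab : a ≠ b) (hac : G.Adj a c) (hdb : G.Adj d b) (p : G.Walk c d)
    (hp : ∀ x ∈ p.support, x ∉ C) : G.Adj a b := by
  obtain ⟨q, hq, hqT⟩ := exists_inducedPath_of_walk (T := {x | x = a ∨ x = b ∨ x ∉ C})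
    (.cons hac (p.concat hdb)) (by
      intro x hx
      simp only [SimpleGraph.Walk.support_cons, SimpleGraph.Walk.support_concat, List.mem_cons,
        List.mem_append, List.not_mem_nil, or_false] at hx
      rcases hx with rfl | hx | rfl
      · exact .inl rfl
      · exact .inr (.inr (hp x hx))
      · exact .inr (.inl rfl))
  have hnil : ¬ q.Nil := fun h => hab h.eq
  have hmem : q.snd ∈ q.support := q.getVert_mem_support 1
  have hadj : G.Adj a q.snd := q.adj_snd hnil
  rcases hqT _ hmem with h | h | h
  · rw [h] at hadj
    exact (G.irrefl hadj).elim
  · exact h ▸ hadj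
  · exact (h (hC a ha b hb q hq _ hmem)).elim

/-- In the graph `G[U]`, removing vertices with a clique boundary from a convex set `U` leaves a
convex set: an induced path that enters `D` and leaves it again would have a chord. -/
theorem IsConvex.diff {U D : Set V} (hU : IsConvex G U) (hD : G.IsClique (boundary G U D)) :
    IsConvex G (U \ D) := by
  intro u hu v hv p hp x hx
  have hpU : ∀ x ∈ p.support, x ∈ U := hU u hu.1 v hv.1 p hp
  refine ⟨hpU x hx, fun hxD => ?_⟩
  obtain ⟨j, rfl, hj⟩ := SimpleGraph.Walk.mem_support_iff_exists_getVert.1 hx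
  -- `i` is the last step before `j` outside `D`, and `k` the first step after `j` outside `D`.
  obtain ⟨i, hij, hi, hi'⟩ : ∃ i < j, p.getVert i ∉ D ∧ p.getVert (i + 1) ∈ D := by
    clear hx hj
    induction j with
    | zero => exact (hu.2 (by simpa using hxD)).elim
    | succ n ih =>
      by_cases h : p.getVert n ∈ D
      · obtain ⟨i, hi, h'⟩ := ih h
        exact ⟨i, by omega, h'⟩
      · exact ⟨n, by omega, h, hxD⟩
  obtain ⟨k, hjk, hkl, hk, hk'⟩ :
      ∃ k, j ≤ k ∧ k < p.length ∧ p.getVert k ∈ D ∧ p.getVert (k + 1) ∉ D := by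
    by_contra! hcon
    have : ∀ n, j ≤ n → n ≤ p.length → p.getVert n ∈ D := by
      intro n hn
      induction n, hn using Nat.le_induction with
      | base => exact fun _ => hxD
      | succ n hn ih => exact fun h => hcon n hn (by omega) (ih (by omega))
    exact hv.2 (by simpa using this p.length hj le_rfl)
  have hbi : p.getVert i ∈ boundary G U D :=
    ⟨hpU _ (p.getVert_mem_support i), hi, _, hi', (p.adj_getVert_succ (by omega)).symm⟩
  have hbk : p.getVert (k + 1) ∈ boundary G U D :=
    ⟨hpU _ (p.getVert_mem_support _), hk', _, hk, p.adj_getVert_succ hkl⟩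
  have hinj := hp.1.getVert_injOn
  have hne : p.getVert i ≠ p.getVert (k + 1) := fun h => by
    have := hinj (show i ≤ p.length by omega)
      (show k + 1 ≤ p.length by omega) h
    omega
  have hedge := hp.2.mem_edges (p.getVert_mem_support i) (p.getVert_mem_support (k + 1))
    (hD hbi hbk hne)
  rw [← SimpleGraph.Walk.adj_toSubgraph_iff_mem_edges, SimpleGraph.Walk.toSubgraph_adj_iff] at hedge
  obtain ⟨l, hl, hlt⟩ := hedge
  rw [Sym2.eq_iff] at hl
  rcases hl with ⟨h₁, h₂⟩ | ⟨h₁, h₂⟩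
  · have e₁ := hinj (show l ≤ p.length by omega) (show i ≤ p.length by omega) h₁
    have e₂ := hinj (show l + 1 ≤ p.length by omega) (show k + 1 ≤ p.length by omega) h₂
    omega
  · have e₁ := hinj (show l ≤ p.length by omega) (show k + 1 ≤ p.length by omega) h₁
    have e₂ := hinj (show l + 1 ≤ p.length by omega) (show i ≤ p.length by omega) h₂
    omega

theorem isConvex_univ : IsConvex G Set.univ := fun _ _ _ _ _ _ _ _ => Set.mem_univ _

/-- Every vertex `v` of `G[U]` outside a convex set `C` lies in a component `D` of `G[U] - C`, and
the boundary of `D` is a clique contained in `C`. -/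
theorem IsConvex.exists_component {C : Set V} (hC : IsConvex G C) (U : Set V) {v : V} (hvU : v ∈ U)
    (hvC : v ∉ C) :
    ∃ D, D ⊆ U \ C ∧ v ∈ D ∧ boundary G U D ⊆ C ∧ G.IsClique (boundary G U D) := by
  set D : Set V := {w | ∃ p : G.Walk v w, ∀ x ∈ p.support, x ∈ U \ C}
  have hDsub : D ⊆ U \ C := fun w ⟨p, hp⟩ => hp w p.end_mem_support
  have hbC : boundary G U D ⊆ C := by
    rintro w ⟨hwU, hwD, d, ⟨p, hp⟩, hdw⟩
    by_contra hwC
    refine hwD ⟨p.concat hdw, fun x hx => ?_⟩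
    rw [SimpleGraph.Walk.support_concat, List.mem_append] at hx
    rcases hx with hx | hx
    · exact hp x hx
    · rw [List.mem_singleton] at hx
      exact hx ▸ ⟨hwU, hwC⟩
  refine ⟨D, hDsub, ⟨.nil, by simpa using ⟨hvU, hvC⟩⟩, hbC, ?_⟩
  intro a ha b hb hab
  obtain ⟨-, -, c, ⟨p, hp⟩, hca⟩ := id ha
  obtain ⟨-, -, d, ⟨q, hq⟩, hdb⟩ := id hb
  refine hC.adj_of_walk (hbC ha) (hbC hb) hab hca.symm hdb (p.reverse.append q) fun x hx => ?_
  rw [SimpleGraph.Walk.mem_support_append_iff, SimpleGraph.Walk.support_reverse,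
    List.mem_reverse] at hx
  exact hx.elim (fun h => (hp x h).2) fun h => (hq x h).2

/-! ### Prime induced subgraphs -/

theorem induce_preconnected_iff {s : Set V} :
    (G.induce s).Preconnected ↔ ∀ A B, A ∪ B = s → Disjoint A B → A.Nonempty → B.Nonempty →
      ∃ a ∈ A, ∃ b ∈ B, G.Adj a b := by
  constructor
  · rintro h A B rfl hdis ⟨a, ha⟩ ⟨b, hb⟩
    obtain ⟨p⟩ := h ⟨a, .inl ha⟩ ⟨b, .inr hb⟩
    obtain ⟨d, -, h₁, h₂⟩ := p.exists_boundary_dart {x | x.1 ∈ A} ha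
      fun h => Set.disjoint_left.1 hdis h hb
    exact ⟨_, h₁, _, d.snd.2.resolve_left h₂, d.adj⟩
  · intro h u v
    by_contra huv
    obtain ⟨_, ⟨x, hx, rfl⟩, _, ⟨y, hy, rfl⟩, hxy⟩ :=
      h (Subtype.val '' {x : s | (G.induce s).Reachable u x})
        (Subtype.val '' {x : s | ¬ (G.induce s).Reachable u x})
        (by
          rw [← Set.image_union]
          ext x
          by_cases hx : x ∈ s
          · simpa [hx] using em _
          · simp [hx])
        ((Set.disjoint_image_iff Subtype.val_injective).2
          (Set.disjoint_left.2 fun x hx hx' => hx' hx))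
        ⟨_, u, SimpleGraph.Reachable.refl u, rfl⟩ ⟨_, v, huv, rfl⟩
    have hadj : (G.induce s).Adj x y := hxy
    exact hy (hx.trans hadj.reachable)

/-- Connectedness is the condition for `Q = ∅`. -/
theorem isPrimeOn_iff {M : Set V} :
    IsPrimeOn G M ↔ M.Nonempty ∧ ∀ Q ⊆ M, G.IsClique Q → ∀ A B, A ∪ B = M \ Q → Disjoint A B →
      A.Nonempty → B.Nonempty → ∃ a ∈ A, ∃ b ∈ B, G.Adj a b := by
  constructor
  · rintro ⟨h, hsep⟩
    refine ⟨Set.nonempty_coe_sort.1 h.nonempty, fun Q hQM hQ => ?_⟩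
    rw [← induce_preconnected_iff]
    by_contra hcon
    exact hsep Q ⟨hQM, hQ, hcon⟩
  · rintro ⟨hne, h⟩
    refine ⟨@SimpleGraph.Connected.mk _ _ ?_ hne.to_subtype, fun C ⟨hCM, hC, hcon⟩ =>
      hcon (induce_preconnected_iff.2 (h C hCM hC))⟩
    have := h ∅ (Set.empty_subset _) (by simp)
    rw [Set.sdiff_empty] at this
    exact induce_preconnected_iff.2 this

theorem isPrimeOn_of_isClique {M : Set V} (hM : G.IsClique M) (hne : M.Nonempty) :
    IsPrimeOn G M := by
  refine isPrimeOn_iff.2 ⟨hne, fun Q _ _ A B hAB hdis ⟨a, ha⟩ ⟨b, hb⟩ => ⟨a, ha, b, hb, ?_⟩⟩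
  have hAB' : A ∪ B ⊆ M := hAB ▸ Set.sdiff_subset
  exact hM (hAB' (.inl ha)) (hAB' (.inr hb)) fun h => Set.disjoint_left.1 hdis ha (h ▸ hb)

/-- A prime subgraph that meets `D` cannot be split by a clique boundary of `D`. -/
theorem IsPrimeOn.subset_union_boundary {U P D : Set V} (hP : IsPrimeOn G P) (hPU : P ⊆ U)
    (hD : G.IsClique (boundary G U D)) (hPD : (P ∩ D).Nonempty) : P ⊆ D ∪ boundary G U D := by
  intro y hyP
  by_contra hy
  obtain ⟨a, ha, b, hb, hab⟩ := (isPrimeOn_iff.1 hP).2 (P ∩ boundary G U D) Set.inter_subset_left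
    (hD.subset Set.inter_subset_right) (P ∩ D) (P \ (D ∪ boundary G U D))
    (by
      ext x
      have : x ∈ boundary G U D → x ∉ D := fun h => h.2.1
      simp only [Set.mem_union, Set.mem_inter_iff, Set.mem_sdiff]
      tauto)
    (Set.disjoint_left.2 fun x hx hx' => hx'.2 (.inl hx.2)) hPD ⟨y, hyP, hy⟩
  exact hb.2 (.inr ⟨hPU hb.1, fun h => hb.2 (.inl h), a, ha.2, hab⟩)

/-- The only convex sets of a prime graph are its cliques and its whole vertex set. -/
theorem IsPrimeOn.subset_of_isConvex {M C : Set V} (hM : IsPrimeOn G M) (hC : IsConvex G C)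
    (h : ¬ G.IsClique (C ∩ M)) : M ⊆ C := by
  intro u huM
  by_contra huC
  obtain ⟨D, hDM, huD, -, hcl⟩ := hC.exists_component M huM huC
  have hsub := hM.subset_union_boundary subset_rfl hcl ⟨u, huM, huD⟩
  exact h (hcl.subset fun x hx => (hsub hx.2).resolve_left fun hxD => (hDM hxD).2 hx.1)

/-! ### Maximal prime subgraphs, their borders and inner parts -/

theorem IsPrimeOn.exists_isMPSubgraph [Finite V] {U P : Set V} (hP : IsPrimeOn G P) (hPU : P ⊆ U) :
    ∃ M, IsMPSubgraph G U M ∧ P ⊆ M := by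
  obtain ⟨M, hPM, hM⟩ := Finite.exists_le_maximal
    (p := fun M => M ⊆ U ∧ IsPrimeOn G M) ⟨hPU, hP⟩
  exact ⟨M, hM, hPM⟩

theorem IsMPSubgraph.eq_of_mem_inner {U M M' : Set V} {v : V} (hM' : IsMPSubgraph G U M')
    (hv : v ∈ inner G U M) (hv' : v ∈ M') : M' = M := by
  by_contra h
  exact hv.2 ⟨hv.1, M', hM', h, hv'⟩

/-- An edge of `G[U]` lies in some mp-subgraph, hence an edge at an inner vertex of `M` lies
in `M`. -/
theorem mem_of_adj_inner [Finite V] {U M : Set V} {v w : V} (hM : IsMPSubgraph G U M)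
    (hv : v ∈ inner G U M) (hw : w ∈ U) (hvw : G.Adj v w) : w ∈ M := by
  obtain ⟨M', hM', hsub⟩ := (isPrimeOn_of_isClique (G := G) (M := {v, w})
    (by simpa [SimpleGraph.isClique_pair] using fun _ => hvw) (by simp)).exists_isMPSubgraph
    (U := U) (Set.insert_subset (hM.prop.1 hv.1) (Set.singleton_subset_iff.2 hw))
  rw [← hM'.eq_of_mem_inner hv (hsub (by simp))]
  exact hsub (by simp)

theorem boundary_inner_diff_subset [Finite V] {U M Y : Set V} (hM : IsMPSubgraph G U M) :
    boundary G U (inner G U M \ Y) ⊆ Y ∪ border G U M := by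
  rintro w ⟨hwU, hw, d, hd, hdw⟩
  have hwM := mem_of_adj_inner hM hd.1 hwU hdw
  by_contra h
  exact hw ⟨⟨hwM, fun h' => h (.inr h')⟩, fun h' => h (.inl h')⟩

/-- If `Y ∪ ∂M` is a clique, deleting the rest of the inner part of `M` leaves a convex set. -/
theorem IsConvex.diff_inner_diff [Finite V] {U M Y : Set V} (hU : IsConvex G U)
    (hM : IsMPSubgraph G U M) (hY : G.IsClique (Y ∪ border G U M)) :
    IsConvex G (U \ (inner G U M \ Y)) :=
  hU.diff (hY.subset (boundary_inner_diff_subset hM))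

theorem IsConvex.diff_inner [Finite V] {U M : Set V} (hU : IsConvex G U) (hM : IsPetal G U M) :
    IsConvex G (U \ inner G U M) := by
  simpa using hU.diff_inner_diff (Y := ∅) hM.1 (by simpa using hM.2.2)

theorem IsFlower.isConvex [Finite V] {U : Set V} (hU : IsFlower G U) : IsConvex G U := by
  induction hU with
  | whole => exact isConvex_univ
  | deletePetal U M _ hM ih => exact ih.diff_inner hM

/-! ### Finding petals -/

/-- If `D` has a clique boundary `K` and `D ∪ K` is prime, then `D ∪ K` is a petal whose inner part
contains `D`. -/
theorem isPetal_union_boundary {U D : Set V} (hDU : D ⊆ U) (hne : D.Nonempty)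
    (hD : G.IsClique (boundary G U D)) (hprime : IsPrimeOn G (D ∪ boundary G U D)) :
    IsPetal G U (D ∪ boundary G U D) ∧ D ⊆ inner G U (D ∪ boundary G U D) := by
  obtain ⟨d, hd⟩ := hne
  have hMP : IsMPSubgraph G U (D ∪ boundary G U D) :=
    ⟨⟨Set.union_subset hDU fun _ h => h.1, hprime⟩, fun P hP hle =>
      hP.2.subset_union_boundary hP.1 hD ⟨d, hle (.inl hd), hd⟩⟩
  have hin : D ⊆ inner G U (D ∪ boundary G U D) := by
    rintro x hx
    refine ⟨.inl hx, fun ⟨_, M', hM', hne, hxM'⟩ => hne ?_⟩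
    exact hM'.eq_of_le hMP.prop
      (hM'.prop.2.subset_union_boundary hM'.prop.1 hD ⟨x, hxM', hx⟩)
  refine ⟨⟨hMP, ⟨d, hin hd⟩, hD.subset fun x hx => ?_⟩, hin⟩
  exact hx.1.resolve_left fun hxD => (hin hxD).2 hx

/-- Behind every clique boundary there is a petal: a minimal nonempty `D' ⊆ D` with a clique boundary
spans a petal together with its boundary. -/
theorem exists_isPetal_of_isClique_boundary [Finite V] {U D : Set V} (hDU : D ⊆ U)
    (hne : D.Nonempty) (hD : G.IsClique (boundary G U D)) :
    ∃ M, IsPetal G U M ∧ M ⊆ D ∪ boundary G U D ∧ (inner G U M ∩ D).Nonempty := by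
  obtain ⟨E, hED, hE⟩ := Finite.exists_le_minimal
    (p := fun E : Set V => E.Nonempty ∧ E ⊆ U ∧ G.IsClique (boundary G U E)) ⟨hne, hDU, hD⟩
  obtain ⟨⟨e, he⟩, hEU, hEcl⟩ := hE.prop
  have hprime : IsPrimeOn G (E ∪ boundary G U E) := by
    refine isPrimeOn_iff.2 ⟨⟨e, .inl he⟩, fun Q hQ hQcl => ?_⟩
    -- The boundary of `E`, a clique, misses one of the two sides of a separation.
    have key : ∀ A B, A ∪ B = (E ∪ boundary G U E) \ Q → Disjoint A B → A.Nonempty →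
        B.Nonempty → Disjoint B (boundary G U E) → ∃ a ∈ A, ∃ b ∈ B, G.Adj a b := by
      rintro A B hAB hdis ⟨a, ha⟩ hBne hBK
      by_contra! hno
      have hA : A ⊆ (E ∪ boundary G U E) \ Q := hAB ▸ Set.subset_union_left
      have hB : B ⊆ (E ∪ boundary G U E) \ Q := hAB ▸ Set.subset_union_right
      have hBE : B ⊆ E := fun x hx => (hB hx).1.resolve_right (Set.disjoint_left.1 hBK hx)
      have hBQ : boundary G U B ⊆ Q := by
        rintro w ⟨hwU, hwB, d, hd, hdw⟩
        by_contra hwQ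
        have hwM : w ∈ E ∪ boundary G U E := by
          by_cases hwE : w ∈ E
          · exact .inl hwE
          · exact .inr ⟨hwU, hwE, d, hBE hd, hdw⟩
        have : w ∈ A ∪ B := hAB ▸ ⟨hwM, hwQ⟩
        exact hno w (this.resolve_right hwB) d hd hdw.symm
      have hEB : E ⊆ B := hE.le_of_le ⟨hBne, hBE.trans hEU, hQcl.subset hBQ⟩ hBE
      rcases (hA ha).1 with haE | ⟨haU, haE, d, hd, hda⟩
      · exact Set.disjoint_left.1 hdis ha (hEB haE)
      · exact hno a ha d (hEB hd) hda.symm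
    intro A B hAB hdis hA hB
    by_cases hBK : Disjoint B (boundary G U E)
    · exact key A B hAB hdis hA hB hBK
    by_cases hAK : Disjoint A (boundary G U E)
    · obtain ⟨b, hb, a, ha, h⟩ := key B A (by rw [Set.union_comm, hAB]) hdis.symm hB hA hAK
      exact ⟨a, ha, b, hb, h.symm⟩
    obtain ⟨a, ha, haK⟩ := Set.not_disjoint_iff.1 hAK
    obtain ⟨b, hb, hbK⟩ := Set.not_disjoint_iff.1 hBK
    exact ⟨a, ha, b, hb, hEcl haK hbK fun h => Set.disjoint_left.1 hdis ha (h ▸ hb)⟩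
  obtain ⟨hpetal, hin⟩ := isPetal_union_boundary hEU ⟨e, he⟩ hEcl hprime
  refine ⟨_, hpetal, ?_, e, hin he, hED he⟩
  rintro x (hx | ⟨hxU, -, d, hd, hdx⟩)
  · exact .inl (hED hx)
  · by_cases hxD : x ∈ D
    · exact .inl hxD
    · exact .inr ⟨hxU, hxD, d, hED hd, hdx⟩

/-- A set with a clique boundary that is not covered by the inner parts of petals contains the whole
inner part of a petal.

With `K` the boundary of `D`, either `D ∪ K` is itself a petal with `D` in its inner part, or a clique
`Q` separates `D ∪ K`, and there is a petal behind `Q` on both sides. The inner parts of these two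
petals are disjoint and not joined by an edge, so the clique `K` cannot meet both. -/
theorem exists_isPetal_inner_subset [Finite V] {U D : Set V} {v : V} (hDU : D ⊆ U)
    (hD : G.IsClique (boundary G U D)) (hvD : v ∈ D)
    (hv : ∀ M, IsPetal G U M → v ∉ inner G U M) :
    ∃ M, IsPetal G U M ∧ inner G U M ⊆ D := by
  by_contra! hcon
  set K := boundary G U D with hK
  have hprime : ¬ IsPrimeOn G (D ∪ K) := fun h =>
    have ⟨h₁, h₂⟩ := isPetal_union_boundary hDU ⟨v, hvD⟩ hD h
    hv _ h₁ (h₂ hvD)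
  rw [isPrimeOn_iff] at hprime
  push Not at hprime
  obtain ⟨Q, hQ, hQcl, A, B, hAB, hdis, hA, hB, hno⟩ := hprime ⟨v, .inl hvD⟩
  -- A petal behind `Q`, on a side `B` disjoint from `K`, has an inner vertex in `K ∩ Q`.
  have key : ∀ A B, A ∪ B = (D ∪ K) \ Q → B.Nonempty → (∀ a ∈ A, ∀ b ∈ B, ¬ G.Adj a b) →
      Disjoint B K → ∃ M, IsPetal G U M ∧ M ⊆ B ∪ Q ∧ (M ∩ B).Nonempty ∧
        ∃ w ∈ inner G U M, w ∈ K ∧ w ∈ Q := by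
    intro A B hAB hBne hno hBK
    have hB : B ⊆ (D ∪ K) \ Q := hAB ▸ Set.subset_union_right
    have hBD : B ⊆ D := fun x hx => (hB hx).1.resolve_right (Set.disjoint_left.1 hBK hx)
    have hBQ : boundary G U B ⊆ Q := by
      rintro w ⟨hwU, hwB, d, hd, hdw⟩
      by_contra hwQ
      have hwM : w ∈ D ∪ K := by
        by_cases hwD : w ∈ D
        · exact .inl hwD
        · exact .inr ⟨hwU, hwD, d, hBD hd, hdw⟩
      have : w ∈ A ∪ B := hAB ▸ ⟨hwM, hwQ⟩
      exact hno w (this.resolve_right hwB) d hd hdw.symm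
    obtain ⟨M, hM, hMsub, x, hxM, hxB⟩ :=
      exists_isPetal_of_isClique_boundary (hBD.trans hDU) hBne (hQcl.subset hBQ)
    have hMBQ : M ⊆ B ∪ Q := hMsub.trans (Set.union_subset_union_right _ hBQ)
    obtain ⟨w, hw, hwD⟩ := Set.not_subset.1 (hcon M hM)
    have hwQ : w ∈ Q := (hMBQ hw.1).resolve_left fun h => hwD (hBD h)
    exact ⟨M, hM, hMBQ, ⟨x, hxM.1, hxB⟩, w, hw, (hQ hwQ).resolve_left hwD, hwQ⟩
  have hKU : K ⊆ U := fun _ h => h.1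
  have hsep : ∀ A B, A ∪ B = (D ∪ K) \ Q → Disjoint A B → A.Nonempty → B.Nonempty →
      (∀ a ∈ A, ∀ b ∈ B, ¬ G.Adj a b) → Disjoint B K → False := by
    intro A B hAB hdis hA hB hno hBK
    have hAsub : A ⊆ (D ∪ K) \ Q := hAB ▸ Set.subset_union_left
    obtain ⟨M, hM, hMBQ, -, w, hw, hwK, hwQ⟩ := key A B hAB hB hno hBK
    -- Every neighbour of the inner vertex `w` lies in `M`, so the clique `K` lies in `M`, which
    -- misses `A`.
    have hKM : K ⊆ M := by
      intro y hy
      by_cases hwy : w = y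
      · exact hwy ▸ hw.1
      · exact mem_of_adj_inner hM.1 hw (hKU hy) (hD hwK hy hwy)
    have hMA : ∀ y ∈ M, y ∉ A := fun y hy hyA =>
      (hMBQ hy).elim (fun h => Set.disjoint_left.1 hdis hyA h) (hAsub hyA).2
    obtain ⟨M', hM', -, ⟨x, hxM', hxA⟩, w', hw', hwK', -⟩ := key B A (by rw [Set.union_comm, hAB])
      hA (fun b hb a ha h => hno a ha b hb h.symm)
      (Set.disjoint_left.2 fun y hyA hyK => hMA y (hKM hyK) hyA)
    have := hM.1.eq_of_mem_inner hw' (hKM hwK')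
    exact hMA x (this ▸ hxM') hxA
  by_cases hBK : Disjoint B K
  · exact hsep A B hAB hdis hA hB hno hBK
  by_cases hAK : Disjoint A K
  · exact hsep B A (by rw [Set.union_comm, hAB]) hdis.symm hB hA
      (fun b hb a ha h => hno a ha b hb h.symm) hAK
  obtain ⟨a, ha, haK⟩ := Set.not_disjoint_iff.1 hAK
  obtain ⟨b, hb, hbK⟩ := Set.not_disjoint_iff.1 hBK
  exact hno a ha b hb (hD haK hbK fun h => Set.disjoint_left.1 hdis ha (h ▸ hb))

/-- A convex set that meets the inner part of every petal contains all vertices that belong to no such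
inner part. -/
theorem IsConvex.mem_of_forall_inter_inner [Finite V] {U C : Set V} {v : V} (hC : IsConvex G C)
    (hmeet : ∀ M, IsPetal G U M → (C ∩ inner G U M).Nonempty) (hvU : v ∈ U)
    (hv : ∀ M, IsPetal G U M → v ∉ inner G U M) : v ∈ C := by
  by_contra hvC
  obtain ⟨D, hDU, hvD, -, hcl⟩ := hC.exists_component U hvU hvC
  obtain ⟨M, hM, hMD⟩ := exists_isPetal_inner_subset (hDU.trans Set.sdiff_subset) hcl hvD hv
  obtain ⟨x, hxC, hxM⟩ := hmeet M hM
  exact (hDU (hMD hxM)).2 hxC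

/-! ### Stamen sets and convex independence -/

/-- The three types of stamen sets, uniformly: a set `T` of inner vertices extends to a stamen set
if and only if `T` minus any of its vertices forms a clique together with the border. -/
theorem exists_isStamenSet_iff [Finite V] {U M T : Set V} (hM : IsPetal G U M) :
    (∃ X, IsStamenSet G U M X ∧ T ⊆ X) ↔
      T ⊆ inner G U M ∧ ∀ u ∈ T, G.IsClique (T \ {u} ∪ border G U M) := by
  have hcl := hM.2.2
  constructor
  · rintro ⟨X, ⟨hXin, hX⟩, hTX⟩
    refine ⟨hTX.trans hXin, fun u hu => ?_⟩
    -- Passing from `T` to the larger `X` only strengthens the conclusion.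
    suffices h : G.IsClique (X \ {u} ∪ border G U M) from
      h.subset (Set.union_subset_union_left _ (Set.sdiff_subset_sdiff_left hTX))
    have hinsert : ∀ w, border G U M ⊆ G.neighborSet w → G.IsClique ({w} ∪ border G U M) :=
      fun w hw => by
        rw [Set.singleton_union]
        exact hcl.insert fun b hb _ => hw hb
    have huX := hTX hu
    rcases hX with ⟨x, rfl⟩ | ⟨a, b, hab, rfl, ha, hb⟩ | ⟨h, -⟩
    · rw [Set.mem_singleton_iff.1 huX]
      simpa using hcl
    · rcases huX with rfl | rfl
      · rw [Set.insert_sdiff_self_of_notMem (by simpa using hab)]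
        exact hinsert b hb
      · refine (hinsert a ha).subset (Set.union_subset_union_left _ ?_)
        rintro x ⟨rfl | rfl, hx⟩
        · rfl
        · exact (hx rfl).elim
    · exact h.subset (Set.union_subset_union_left _ Set.sdiff_subset)
  · rintro ⟨hTin, hT⟩
    have hmem : ∀ x ∈ T, ∀ u ∈ T, x ≠ u → border G U M ⊆ G.neighborSet x := by
      intro x hx u hu hxu b hb
      exact hT u hu (.inl ⟨hx, hxu⟩) (.inr hb) fun h => (hTin hx).2 (h ▸ hb)
    rcases T.eq_empty_or_nonempty with rfl | ⟨a, ha⟩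
    · obtain ⟨x, hx⟩ := hM.2.1
      exact ⟨{x}, ⟨Set.singleton_subset_iff.2 hx, .inl ⟨x, rfl⟩⟩, Set.empty_subset _⟩
    by_cases h₁ : T = {a}
    · exact ⟨T, ⟨hTin, .inl ⟨a, h₁⟩⟩, subset_rfl⟩
    obtain ⟨b, hb, hba⟩ : ∃ b ∈ T, b ≠ a := by
      by_contra! h
      exact h₁ (Set.eq_singleton_iff_unique_mem.2 ⟨ha, h⟩)
    have hpair : ({a, b} : Set V) ⊆ T := Set.insert_subset ha (Set.singleton_subset_iff.2 hb)
    by_cases h₂ : T = {a, b}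
    · exact ⟨T, ⟨hTin, .inr (.inl ⟨a, b, hba.symm, h₂, hmem a ha b hb hba.symm,
        hmem b hb a ha hba⟩)⟩, subset_rfl⟩
    obtain ⟨c, hc, hcab⟩ := Set.not_subset.1 fun h => h₂ (h.antisymm hpair)
    simp only [Set.mem_insert_iff, Set.mem_singleton_iff, not_or] at hcab
    refine ⟨T, ⟨hTin, .inr (.inr ⟨?_, ?_⟩)⟩, subset_rfl⟩
    · -- Given two vertices of `T ∪ ∂M`, one of `a`, `b`, `c` differs from both.
      intro x hx y hy hxy
      obtain ⟨u, hu, hxu, hyu⟩ : ∃ u ∈ T, x ≠ u ∧ y ≠ u := by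
        by_contra! h
        have e₁ := h a ha
        have e₂ := h b hb
        have e₃ := h c hc
        grind
      exact hT u hu (hx.imp_left fun h => ⟨h, hxu⟩) (hy.imp_left fun h => ⟨h, hyu⟩) hxy
    · rw [← Set.ncard_pair hba.symm]
      exact Set.ncard_le_ncard hpair

theorem exists_isMinFlowerContainingHull [Finite V] (G : SimpleGraph V) (S : Set V) :
    ∃ H, IsMinFlowerContainingHull G S H := by
  obtain ⟨H, -, hH⟩ := Finite.exists_le_minimal
    (p := fun U => IsFlower G U ∧ hull G S ⊆ U) (a := Set.univ)
    ⟨IsFlower.whole, Set.subset_univ _⟩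
  exact ⟨H, hH⟩

/-- By minimality of `H`, the set `S` cannot avoid the inner part of a petal, since what remains
after deleting it is convex. -/
theorem IsMinFlowerContainingHull.inter_inner_nonempty [Finite V] {S H M : Set V}
    (hH : IsMinFlowerContainingHull G S H) (hM : IsPetal G H M) : (S ∩ inner G H M).Nonempty := by
  by_contra hcon
  have hSH : S ⊆ H \ inner G H M := fun x hx =>
    ⟨hH.prop.2 ((hull_isLeast G S).1.2 hx), fun h => hcon ⟨x, hx, h⟩⟩
  have hflower := IsFlower.deletePetal H M hH.prop.1 hM
  obtain ⟨x, hx⟩ := hM.2.1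
  exact (hH.le_of_le ⟨hflower, (hull_isLeast G S).2 ⟨hflower.isConvex, hSH⟩⟩
    Set.sdiff_subset (hM.1.prop.1 hx.1)).2 hx

theorem not_mem_inner_of_mem_border {U M N : Set V} {v : V} (hM : IsMPSubgraph G U M)
    (hv : v ∈ border G U M) : v ∉ inner G U N := by
  intro hvN
  obtain ⟨M', hM', hne, hvM'⟩ := hv.2
  exact hne ((hM'.eq_of_mem_inner hvN hvM').trans (hM.eq_of_mem_inner hvN hv.1).symm)

/-- An element of an independent set lies in the inner part of a petal: otherwise the remaining
elements still meet the inner part of every petal, and their hull contains it. -/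
theorem IsConvexlyIndependent.exists_mem_inner [Finite V] {S H : Set V} {u : V}
    (hS : IsConvexlyIndependent G S) (hH : IsMinFlowerContainingHull G S H) (hu : u ∈ S) :
    ∃ M, IsPetal G H M ∧ u ∈ inner G H M := by
  by_contra! hcon
  refine hS u hu ((hull_isLeast G _).1.1.mem_of_forall_inter_inner (U := H) (fun M hM => ?_)
    (hH.prop.2 ((hull_isLeast G S).1.2 hu)) hcon)
  obtain ⟨x, hxS, hxM⟩ := hH.inter_inner_nonempty hM
  exact ⟨x, (hull_isLeast G _).1.2 ⟨hxS, fun h => hcon M hM (h ▸ hxM)⟩, hxM⟩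

/-- If the set in the conclusion were no clique, then the hull of `S \ {u}` would meet the inner part
of every petal, hence contain the border of `M` and two nonadjacent vertices of `M`. As `M` is
prime, it would contain `M`, and `u` with it. -/
theorem IsConvexlyIndependent.isClique [Finite V] {S H M : Set V} {u : V}
    (hS : IsConvexlyIndependent G S) (hH : IsMinFlowerContainingHull G S H) (hM : IsPetal G H M)
    (hSM : S ∩ M ⊆ inner G H M) (hu : u ∈ S ∩ M) :
    G.IsClique ((S ∩ M) \ {u} ∪ border G H M) := by
  by_contra hcon
  obtain ⟨hconv, hsub⟩ := (hull_isLeast G (S \ {u})).1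
  refine hS u hu.1 (hM.1.prop.2.subset_of_isConvex hconv (fun hcl => hcon (hcl.subset ?_)) hu.2)
  have hmeet : ∀ N, IsPetal G H N → (hull G (S \ {u}) ∩ inner G H N).Nonempty := by
    intro N hN
    by_cases hNM : N = M
    · subst hNM
      -- The border is a clique, so a nonadjacent pair involves a vertex of `S ∩ N` other than `u`.
      have hne : ((S ∩ N) \ {u}).Nonempty := by
        by_contra h
        rw [Set.not_nonempty_iff_eq_empty] at h
        exact hcon (by simpa [h] using hM.2.2)
      obtain ⟨x, hx, hxu⟩ := hne
      exact ⟨x, hsub ⟨hx.1, hxu⟩, hSM hx⟩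
    · obtain ⟨x, hxS, hxN⟩ := hH.inter_inner_nonempty hN
      refine ⟨x, hsub ⟨hxS, fun hxu => hNM ?_⟩, hxN⟩
      exact hN.1.eq_of_mem_inner (hSM hu) (hxu ▸ hxN.1)
  rintro x (⟨⟨hxS, hxM⟩, hxu⟩ | hx)
  · exact ⟨hsub ⟨hxS, hxu⟩, hxM⟩
  · exact ⟨hconv.mem_of_forall_inter_inner hmeet (hM.1.prop.1 hx.1)
      fun N _ => not_mem_inner_of_mem_border hM.1 hx, hx.1⟩

/-- The convex set `H \ (M° \ Y)` with `Y = (S ∩ M) \ {u}` contains `S \ {u}` and misses `u`. -/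
theorem not_mem_hull_diff_singleton [Finite V] {S H M : Set V} {u : V} (hH : IsConvex G H)
    (hSH : S ⊆ H) (hM : IsMPSubgraph G H M) (huM : u ∈ inner G H M)
    (hcl : G.IsClique ((S ∩ M) \ {u} ∪ border G H M)) : u ∉ hull G (S \ {u}) := by
  intro hu
  refine ((hull_isLeast G _).2 ⟨hH.diff_inner_diff hM hcl, fun x hx => ?_⟩ hu).2
    ⟨huM, fun h => h.2 rfl⟩
  exact ⟨hSH hx.1, fun h => h.2 ⟨⟨hx.1, h.1.1⟩, hx.2⟩⟩

end Monophonic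

open Monophonic in
theorem theorem2 {V : Type*} [Finite V] (G : SimpleGraph V) (hG : G.Connected) (S : Set V) :
    (∃ H : Set V, Monophonic.IsMinFlowerContainingHull G S H) ∧
    ∀ H : Set V, Monophonic.IsMinFlowerContainingHull G S H →
      (Monophonic.IsConvexlyIndependent G S ↔
        ∀ M : Set V, Monophonic.IsMPSubgraph G H M →
          (Monophonic.IsPetal G H M →
            ∃ X : Set V, Monophonic.IsStamenSet G H M X ∧ S ∩ M ⊆ X) ∧
          (¬ Monophonic.IsPetal G H M → S ∩ M = ∅)) := by
  refine ⟨exists_isMinFlowerContainingHull G S, fun H hH => ⟨fun hS M hM => ?_, fun h u hu => ?_⟩⟩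
  · have hpetal : ∀ u ∈ S ∩ M, IsPetal G H M ∧ u ∈ inner G H M := fun u hu => by
      obtain ⟨N, hN, huN⟩ := hS.exists_mem_inner hH hu.1
      rw [hM.eq_of_mem_inner huN hu.2]
      exact ⟨hN, huN⟩
    refine ⟨fun hMP => ?_, fun hMP => ?_⟩
    · have hin : S ∩ M ⊆ inner G H M := fun u hu => (hpetal u hu).2
      exact (exists_isStamenSet_iff hMP).2 ⟨hin, fun u hu => hS.isClique hH hMP hin hu⟩
    · exact Set.eq_empty_iff_forall_notMem.2 fun u hu => hMP (hpetal u hu).1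
  · have hSH : S ⊆ H := (hull_isLeast G S).1.2.trans hH.prop.2
    obtain ⟨M, hM, huM⟩ := (isPrimeOn_of_isClique (G := G) (M := {u}) (by simp)
      (by simp)).exists_isMPSubgraph (Set.singleton_subset_iff.2 (hSH hu))
    have huSM : u ∈ S ∩ M := ⟨hu, huM rfl⟩
    have hMP : IsPetal G H M := by
      by_contra hMP
      exact Set.eq_empty_iff_forall_notMem.1 ((h M hM).2 hMP) u huSM
    obtain ⟨hin, hcl⟩ := (exists_isStamenSet_iff hMP).1 ((h M hM).1 hMP)
    exact not_mem_hull_diff_singleton hH.prop.1.isConvex hSH hM (hin huSM) (hcl u huSM)
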